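/- Let $n,N\ge 1$ and $l_1,\dots,l_N\ge 1$ be integers. Let $R_1,\dots,R_N$ be independent Haar distributed random real orthogonal matrices, $R_i$ of size $(n+l_i)\times(n+l_i)$, let $A_i$ be the top left $n\times n$ block of $R_i$, and let $X_{N,n}=A_N\cdots A_1$. Put $$\mu_{n,l}=\frac1N\sum_{i=1}^N\mathbb E\log B_i,\quad B_i\sim\operatorname{Beta}\Big(\frac n2,\frac{l_i}2\Big),\qquad M_i=\frac{n^2(n+l_i+2)}{(n+l_i)^2},\qquad \hat M=\Big(\frac1N\sum_{j=1}^N\frac1{M_j}\Big)^{-1}.$$ There is a universal constant $c>0$ (independent of $n$, $N$, $l_1,\dots,l_N$, $\theta$ and $s$) such that for every fixed unit vector $\theta\in\mathbb R^n$ and every $s>0$, $$\mathbb P\left(\left|\frac1N\log\|X_{N,n}\theta\|-\frac12\mu_{n,l}\right|\ge s\right)\le 2\exp\left\{-cN\min\{\hat M s^2,\;M_N s\}\right\},$$ where $\|\cdot\|$ is the Euclidean norm. -/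

import Mathlib

open MeasureTheory ProbabilityTheory

noncomputable section

namespace TruncatedProduct

/-- The orthogonal group `O(m)` carries its Borel σ-algebra. -/
instance instMeasurableSpaceOrthogonalGroup (m : ℕ) :
    MeasurableSpace (Matrix.orthogonalGroup (Fin m) ℝ) := borel _

instance instBorelSpaceOrthogonalGroup (m : ℕ) :
    BorelSpace (Matrix.orthogonalGroup (Fin m) ℝ) := ⟨rfl⟩

/-- A random orthogonal matrix is Haar distributed if its law is a Haar measure on `O(m)`. For a
probability measure `P` the law has mass one, so it is the normalized Haar measure. -/
def IsHaarDistributed {Ω : Type*} [MeasurableSpace Ω] (P : Measure Ω) {m : ℕ}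
    (R : Ω → Matrix.orthogonalGroup (Fin m) ℝ) : Prop :=
  Measurable R ∧ (P.map R).IsHaarMeasure

/-- The top left `n × n` block of an orthogonal matrix of size `(n + l) × (n + l)`. -/
def truncation {n l : ℕ} (R : Matrix.orthogonalGroup (Fin (n + l)) ℝ) :
    Matrix (Fin n) (Fin n) ℝ :=
  (R : Matrix (Fin (n + l)) (Fin (n + l)) ℝ).submatrix (Fin.castAdd l) (Fin.castAdd l)

/-- The ordered product `A_N ⋯ A_2 A_1`; the index `i : Fin N` stands for `i + 1`. -/
def orderedProduct {n N : ℕ} (A : Fin N → Matrix (Fin n) (Fin n) ℝ) :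
    Matrix (Fin n) (Fin n) ℝ :=
  (List.ofFn A).reverse.prod

/-- The product `X_{N,n} = A_N ⋯ A_1` of the truncations `A_i` of the matrices `R_i`. -/
def truncatedProduct {n N : ℕ} {l : Fin N → ℕ}
    (R : (i : Fin N) → Matrix.orthogonalGroup (Fin (n + l i)) ℝ) :
    Matrix (Fin n) (Fin n) ℝ :=
  orderedProduct fun i => truncation (R i)

/-- The mean of `log B` for `B ∼ Beta(n/2, l/2)`. -/
def logBetaMean (n l : ℕ) : ℝ :=
  ∫ x, Real.log x ∂betaMeasure ((n : ℝ) / 2) ((l : ℝ) / 2)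

/-- `μ_{n,l} = (1/N) ∑ᵢ μ_{n,lᵢ}`. -/
def averageMean (n : ℕ) {N : ℕ} (l : Fin N → ℕ) : ℝ :=
  (1 / (N : ℝ)) * ∑ i, logBetaMean n (l i)

/-- `M_i = n² (n + l_i + 2) / (n + l_i)²`, as a function of `n` and `l_i`. -/
def rate (n l : ℕ) : ℝ :=
  (n : ℝ) ^ 2 * ((n : ℝ) + l + 2) / ((n : ℝ) + l) ^ 2

/-- The harmonic mean of `M_1, …, M_N`. -/
def harmonicRate (n : ℕ) {N : ℕ} (l : Fin N → ℕ) : ℝ :=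
  (N : ℝ) / ∑ i, 1 / rate n (l i)

end TruncatedProduct

end

/-!
The point is that `log ‖X θ‖²` is distributed as a sum of independent variables `log Bᵢ`, and that
`log B` for `B ∼ Beta(a, b)` is sub-exponential with constants of order `a` that do not depend on
`b`. Since `rate n l ≤ 2 n`, the exponents in the claim are weaker than what this yields.

*One factor.* If `R` is Haar distributed on `O(n + l)` and `v ∈ ℝⁿ`, then `A v` consists of the
first `n` coordinates of `R (v, 0)`. Integrate `‖(x₁, …, xₙ)‖ ^ t` against the weight `exp (-‖x‖²)`
on `ℝ ^ (n + l)`. Replacing `x` by `R x` changes nothing for a fixed `R`, whereas for a fixed `x`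
the law of `R x` depends only on `‖x‖`, by right invariance of Haar measure. Fubini's theorem thus
gives `gaussianMoment_mul_lintegral`, which expresses the moments of `‖A v‖` by Gaussian radial
integrals, that is, by Gamma functions: they are those of the square root of a `Beta(n/2, l/2)`
variable (`lintegral_truncation`).

*The product.* Conditionally on `A₁`, the product `A_N ⋯ A₂` acts on the fixed vector `A₁ θ`, so the
moments multiply (`lintegral_truncatedProduct`). All moments are taken in `ℝ≥0∞`, where `0 ^ t = ∞`
for `t < 0`; a finite negative moment then shows that `X θ ≠ 0` almost surely.

*The beta distribution.* The cumulant generating function of `log B` is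
`log Γ(a + t) - log Γ(a) - log Γ(a + b + t) + log Γ(a + b)`. The terms containing `b` are concave in
`t`, because `log Γ` is convex, and `(log Γ)'' ≤ 1 / y² + 1 / y` on `[y, ∞)`
(`concaveOn_log_Gamma_sub_sq`). Comparison with the tangent line at `0`, whose slope is the mean of
`log B`, gives `mgf_log_betaMeasure_le`. Chernoff's bound (`measureReal_le_of_mgf_le`) concludes.
-/

namespace TruncatedProduct

open Matrix (toEuclideanLin)
open scoped ENNReal

/-! ### Logarithms of beta variables -/

lemma sum_one_div_sq_le {x : ℝ} (hx : 0 < x) (k : ℕ) :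
    ∑ m ∈ Finset.range (k + 1), 1 / (x + m) ^ 2 ≤ 1 / x ^ 2 + 1 / x - 1 / (x + k) := by
  induction k with
  | zero => simp
  | succ k ih =>
    rw [Finset.sum_range_succ]
    have h1 : 0 < x + k := by positivity
    have : 1 / (x + (k + 1 : ℕ)) ^ 2 ≤ 1 / (x + k) - 1 / (x + (k + 1 : ℕ)) := by
      push_cast
      rw [div_sub_div _ _ (by positivity) (by positivity), div_le_div_iff₀ (by positivity)
        (by positivity)]
      nlinarith
    linarith

lemma concaveOn_logGammaSeq_sub_sq {y : ℝ} (hy : 0 < y) (n : ℕ) :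
    ConcaveOn ℝ (Set.Ici y) fun x =>
      Real.BohrMollerup.logGammaSeq x n - (1 / y ^ 2 + 1 / y) / 2 * x ^ 2 := by
  have hd : ∀ x : ℝ, 0 < x → HasDerivAt (fun x : ℝ => Real.BohrMollerup.logGammaSeq x n
      - (1 / y ^ 2 + 1 / y) / 2 * x ^ 2)
      (Real.log n - ∑ m ∈ Finset.range (n + 1), (x + m)⁻¹ - (1 / y ^ 2 + 1 / y) * x) x := by
    intro x hx
    unfold Real.BohrMollerup.logGammaSeq
    have hs : HasDerivAt (fun x : ℝ => ∑ m ∈ Finset.range (n + 1), Real.log (x + m))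
        (∑ m ∈ Finset.range (n + 1), (x + m)⁻¹) x := by
      refine HasDerivAt.fun_sum fun m _ => ?_
      have h0 : x + m ≠ 0 := by positivity
      simpa using ((hasDerivAt_id x).add_const (m : ℝ)).log h0
    have h := ((((hasDerivAt_id x).mul_const (Real.log n)).add_const
      (Real.log (n.factorial))).sub hs).sub
      ((hasDerivAt_pow 2 x).const_mul ((1 / y ^ 2 + 1 / y) / 2))
    refine h.congr_deriv ?_
    push_cast
    ring
  have hd2 : ∀ x : ℝ, 0 < x → HasDerivAt (fun x : ℝ => Real.log n
      - ∑ m ∈ Finset.range (n + 1), (x + m)⁻¹ - (1 / y ^ 2 + 1 / y) * x)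
      (∑ m ∈ Finset.range (n + 1), 1 / (x + m) ^ 2 - (1 / y ^ 2 + 1 / y)) x := by
    intro x hx
    have hs : HasDerivAt (fun x : ℝ => ∑ m ∈ Finset.range (n + 1), (x + m)⁻¹)
        (∑ m ∈ Finset.range (n + 1), -(1 / (x + m) ^ 2)) x := by
      refine HasDerivAt.fun_sum fun m _ => ?_
      have h0 : x + m ≠ 0 := by positivity
      refine (((hasDerivAt_id x).add_const (m : ℝ)).fun_inv h0).congr_deriv ?_
      simp [neg_div]
    refine ((hs.const_sub (Real.log n)).sub
      ((hasDerivAt_id x).const_mul (1 / y ^ 2 + 1 / y))).congr_deriv ?_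
    simp [Finset.sum_neg_distrib]
  have hpos : ∀ x ∈ interior (Set.Ici y), 0 < x ∧ y ≤ x := fun x hx => by
    rw [interior_Ici] at hx
    exact ⟨hy.trans hx, le_of_lt hx⟩
  refine concaveOn_of_hasDerivWithinAt2_nonpos (convex_Ici y)
    (fun x hx => (hd x (hy.trans_le hx)).continuousAt.continuousWithinAt)
    (fun x hx => (hd x (hpos x hx).1).hasDerivWithinAt)
    (fun x hx => (hd2 x (hpos x hx).1).hasDerivWithinAt) fun x hx => ?_
  obtain ⟨hx0, hyx⟩ := hpos x hx
  have h := sum_one_div_sq_le hx0 n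
  have h1 : 1 / x ^ 2 ≤ 1 / y ^ 2 := by gcongr
  have h2 : 1 / x ≤ 1 / y := by gcongr
  have h3 : 0 ≤ 1 / (x + n) := by positivity
  linarith

/-- The second derivative of `log Γ` is at most `1 / y² + 1 / y` on `[y, ∞)`, stated as concavity
so that it passes to the limit in the Bohr–Mollerup approximation of `log Γ`. -/
lemma concaveOn_log_Gamma_sub_sq {y : ℝ} (hy : 0 < y) :
    ConcaveOn ℝ (Set.Ici y) fun x =>
      Real.log (Real.Gamma x) - (1 / y ^ 2 + 1 / y) / 2 * x ^ 2 := by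
  have ht : ∀ x ∈ Set.Ici y, Filter.Tendsto (fun n => Real.BohrMollerup.logGammaSeq x n
      - (1 / y ^ 2 + 1 / y) / 2 * x ^ 2) Filter.atTop
      (nhds (Real.log (Real.Gamma x) - (1 / y ^ 2 + 1 / y) / 2 * x ^ 2)) := fun x hx =>
    (Real.BohrMollerup.tendsto_log_gamma (hy.trans_le hx)).sub_const _
  refine ⟨convex_Ici y, fun u hu v hv p q hp hq hpq => ?_⟩
  refine le_of_tendsto_of_tendsto' (((ht u hu).const_smul p).add ((ht v hv).const_smul q))
    (ht _ (convex_Ici y hu hv hp hq hpq)) fun n => ?_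
  exact (concaveOn_logGammaSeq_sub_sq hy n).2 hu hv hp hq hpq

/-- Moments of the beta distribution: multiplying the density of `Beta(a, b)` by `x ^ t` gives a
multiple of the density of `Beta(a + t, b)`. -/
lemma lintegral_exp_mul_log_betaMeasure {a b t : ℝ} (ha : 0 < a) (hb : 0 < b) (hat : 0 < a + t) :
    ∫⁻ x, ENNReal.ofReal (Real.exp (t * Real.log x)) ∂betaMeasure a b
      = ENNReal.ofReal (beta (a + t) b / beta a b) := by
  have hA := beta_pos ha hb
  have hB := beta_pos hat hb
  have hm : Measurable (betaPDF a b) := (measurable_betaPDFReal a b).ennreal_ofReal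
  have hm' : Measurable (betaPDF (a + t) b) := (measurable_betaPDFReal (a + t) b).ennreal_ofReal
  rw [betaMeasure, lintegral_withDensity_eq_lintegral_mul _ hm (by fun_prop)]
  have : ∀ x, (betaPDF a b * fun x => ENNReal.ofReal (Real.exp (t * Real.log x))) x
      = ENNReal.ofReal (beta (a + t) b / beta a b) * betaPDF (a + t) b x := by
    intro x
    rw [Pi.mul_apply, betaPDF_eq, betaPDF_eq]
    split_ifs with h
    · have h1 : 0 < 1 - x := sub_pos.2 h.2
      have h0 := h.1
      rw [← ENNReal.ofReal_mul (by positivity), ← ENNReal.ofReal_mul (by positivity)]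
      congr 1
      rw [mul_comm t, ← Real.rpow_def_of_pos h.1, show a + t - 1 = (a - 1) + t by ring,
        Real.rpow_add h.1]
      field_simp
    · simp
  simp_rw [this]
  rw [lintegral_const_mul _ hm', lintegral_betaPDF_eq_one hat hb, mul_one]

lemma integrable_exp_mul_log_betaMeasure {a b t : ℝ} (ha : 0 < a) (hb : 0 < b) (hat : 0 < a + t) :
    Integrable (fun x => Real.exp (t * Real.log x)) (betaMeasure a b) := by
  refine ⟨by fun_prop, ?_⟩
  rw [hasFiniteIntegral_iff_ofReal (.of_forall fun x => (Real.exp_pos _).le),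
    lintegral_exp_mul_log_betaMeasure ha hb hat]
  exact ENNReal.ofReal_lt_top

lemma mgf_log_betaMeasure {a b t : ℝ} (ha : 0 < a) (hb : 0 < b) (hat : 0 < a + t) :
    mgf Real.log (betaMeasure a b) t = beta (a + t) b / beta a b := by
  rw [mgf, integral_eq_lintegral_of_nonneg_ae (.of_forall fun x => (Real.exp_pos _).le)
    (by fun_prop), lintegral_exp_mul_log_betaMeasure ha hb hat, ENNReal.toReal_ofReal]
  exact (div_pos (beta_pos hat hb) (beta_pos ha hb)).le

lemma log_beta {a b : ℝ} (ha : 0 < a) (hb : 0 < b) :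
    Real.log (beta a b) = Real.log (Real.Gamma a) + Real.log (Real.Gamma b)
      - Real.log (Real.Gamma (a + b)) := by
  have h1 := Real.Gamma_pos_of_pos ha
  have h2 := Real.Gamma_pos_of_pos hb
  have h3 := Real.Gamma_pos_of_pos (add_pos ha hb)
  rw [beta, Real.log_div (by positivity) h3.ne', Real.log_mul h1.ne' h2.ne']

/-- A concave function lies below its tangent lines. -/
lemma le_add_deriv_mul_of_concaveOn {f : ℝ → ℝ} {S : Set ℝ} (hf : ConcaveOn ℝ S f) {x y f' : ℝ}
    (hx : x ∈ S) (hy : y ∈ S) (hd : HasDerivAt f f' x) : f y ≤ f x + f' * (y - x) := by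
  rcases lt_trichotomy x y with h | rfl | h
  · have := hf.slope_le_of_hasDerivAt hx hy h hd
    rw [slope_def_field, div_le_iff₀ (sub_pos.2 h)] at this
    linarith
  · simp
  · have := hf.le_slope_of_hasDerivAt hy hx h hd
    rw [slope_def_field, le_div_iff₀ (sub_pos.2 h)] at this
    linarith

/-- The logarithm of a beta variable is sub-exponential, with a variance proxy that depends only
on the first parameter: the terms of the cumulant generating function that contain the second one
are concave, so the tangent line at `0` bounds them. The lower bound on `a` serves to
absorb `1 / a²` into `1 / a`. -/
lemma mgf_log_betaMeasure_le {a b t : ℝ} (ha : 1 / 2 ≤ a) (hb : 0 < b) (ht : -(a / 2) ≤ t) :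
    mgf Real.log (betaMeasure a b) t
      ≤ Real.exp (t * ∫ x, Real.log x ∂betaMeasure a b + 5 / a * t ^ 2) := by
  have ha0 : 0 < a := by linarith
  have := isProbabilityMeasureBeta ha0 hb
  set K := cgf Real.log (betaMeasure a b) with hK
  set y := a / 2 with hy
  have hy0 : 0 < y := by positivity
  set Q := (1 / y ^ 2 + 1 / y) / 2 with hQ
  have hKeq : ∀ u ∈ Set.Ici (-y), K u = Real.log (Real.Gamma (a + u)) -
      Real.log (Real.Gamma (a + u + b)) - (Real.log (Real.Gamma a) -
      Real.log (Real.Gamma (a + b))) := by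
    intro u hu
    have hau : 0 < a + u := by rw [Set.mem_Ici] at hu; linarith
    rw [hK, cgf, mgf_log_betaMeasure ha0 hb hau, Real.log_div (beta_pos hau hb).ne'
      (beta_pos ha0 hb).ne', log_beta hau hb, log_beta ha0 hb]
    ring
  have hint : (0 : ℝ) ∈ interior (integrableExpSet Real.log (betaMeasure a b)) := by
    rw [mem_interior]
    exact ⟨Set.Ioi (-a), fun u hu => integrable_exp_mul_log_betaMeasure ha0 hb
      (by rw [Set.mem_Ioi] at hu; linarith), isOpen_Ioi, by simpa using ha0⟩
  have hderiv : HasDerivAt K (∫ x, Real.log x ∂betaMeasure a b) 0 := by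
    have h1 : DifferentiableAt ℝ K 0 := (analyticAt_cgf hint).differentiableAt
    have h2 := h1.hasDerivAt
    rw [hK, deriv_cgf_zero hint] at h2
    simpa using h2
  -- The quadratic is centred at `-a`, so that the `log Γ` bound applies after a translation.
  have hconc : ConcaveOn ℝ (Set.Ici (-y)) fun u => K u - Q * (a + u) ^ 2 := by
    have h1 : ConcaveOn ℝ (Set.Ici (-y)) fun u =>
        Real.log (Real.Gamma (a + u)) - Q * (a + u) ^ 2 := by
      refine ((concaveOn_log_Gamma_sub_sq hy0).translate_right a).subset ?_ (convex_Ici _)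
      intro u hu
      simp only [Set.mem_preimage, Set.mem_Ici] at hu ⊢
      linarith
    have h2 : ConvexOn ℝ (Set.Ici (-y)) fun u => Real.log (Real.Gamma (a + u + b)) := by
      refine ((Real.convexOn_log_Gamma.translate_right (a + b)).subset ?_ (convex_Ici _)).congr ?_
      · intro u hu
        simp only [Set.mem_preimage, Set.mem_Ici, Set.mem_Ioi] at hu ⊢
        linarith
      · intro u _
        simp [add_right_comm]
    refine ((h1.sub h2).add_const (-(Real.log (Real.Gamma a) -
      Real.log (Real.Gamma (a + b))))).congr fun u hu => ?_
    simp only [Pi.add_apply, Pi.sub_apply, hKeq u hu]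
    ring
  have hd : HasDerivAt (fun u => K u - Q * (a + u) ^ 2)
      ((∫ x, Real.log x ∂betaMeasure a b) - Q * (2 * a)) 0 := by
    refine (hderiv.sub ((((hasDerivAt_id (0 : ℝ)).const_add a).pow 2).const_mul Q)).congr_deriv ?_
    simp
  have h := le_add_deriv_mul_of_concaveOn hconc (by simpa using hy0.le) ht hd
  have hK0 : K 0 = 0 := by rw [hK, cgf_zero]
  have hQa : Q ≤ 5 / a := by
    have : Q = 2 / a ^ 2 + 1 / a := by rw [hQ, hy]; field_simp
    rw [this]
    have : 2 / a ^ 2 ≤ 4 / a := by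
      rw [div_le_div_iff₀ (by positivity) ha0]
      nlinarith
    calc 2 / a ^ 2 + 1 / a ≤ 4 / a + 1 / a := by gcongr
      _ = 5 / a := by ring
  have hmp : 0 < mgf Real.log (betaMeasure a b) t := by
    rw [mgf_log_betaMeasure ha0 hb (by linarith)]
    exact div_pos (beta_pos (by linarith) hb) (beta_pos ha0 hb)
  rw [← Real.log_le_iff_le_exp hmp]
  change K t ≤ _
  have : Q * t ^ 2 ≤ 5 / a * t ^ 2 := by gcongr
  simp only [hK0] at h
  nlinarith

/-! ### The action of the orthogonal group on Euclidean space -/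

lemma norm_toEuclideanLin_orthogonal {m : ℕ} (R : Matrix.orthogonalGroup (Fin m) ℝ)
    (x : EuclideanSpace ℝ (Fin m)) :
    ‖toEuclideanLin (R : Matrix (Fin m) (Fin m) ℝ) x‖ = ‖x‖ := by
  have hR : (R : Matrix (Fin m) (Fin m) ℝ).conjTranspose * (R : Matrix (Fin m) (Fin m) ℝ) = 1 :=
    Matrix.mem_unitaryGroup_iff'.1 R.2
  have h : inner ℝ (toEuclideanLin (R : Matrix (Fin m) (Fin m) ℝ) x)
      (toEuclideanLin (R : Matrix (Fin m) (Fin m) ℝ) x) = inner ℝ x x := by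
    rw [← LinearMap.adjoint_inner_left, ← Matrix.toEuclideanLin_conjTranspose_eq_adjoint]
    congr 1
    rw [Matrix.toLpLin_apply, Matrix.toLpLin_apply, Matrix.mulVec_mulVec, hR, Matrix.one_mulVec]
  rw [real_inner_self_eq_norm_sq, real_inner_self_eq_norm_sq] at h
  exact (pow_left_inj₀ (norm_nonneg _) (norm_nonneg _) two_ne_zero).1 h

/-- An orthogonal matrix as an isometry of Euclidean space. -/
noncomputable def rotation {m : ℕ} (R : Matrix.orthogonalGroup (Fin m) ℝ) :
    EuclideanSpace ℝ (Fin m) ≃ₗᵢ[ℝ] EuclideanSpace ℝ (Fin m) :=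
  LinearIsometry.toLinearIsometryEquiv
    ⟨toEuclideanLin (R : Matrix (Fin m) (Fin m) ℝ), norm_toEuclideanLin_orthogonal R⟩ rfl

lemma rotation_apply {m : ℕ} (R : Matrix.orthogonalGroup (Fin m) ℝ)
    (x : EuclideanSpace ℝ (Fin m)) :
    rotation R x = toEuclideanLin (R : Matrix (Fin m) (Fin m) ℝ) x := rfl

lemma rotation_mul {m : ℕ} (R Q : Matrix.orthogonalGroup (Fin m) ℝ)
    (x : EuclideanSpace ℝ (Fin m)) : rotation (R * Q) x = rotation R (rotation Q x) := by
  simp [rotation_apply, Matrix.toLpLin_apply, Matrix.mulVec_mulVec]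

/-- The orthogonal group acts transitively on spheres. -/
lemma exists_rotation_eq {m : ℕ} {v w : EuclideanSpace ℝ (Fin m)} (h : ‖v‖ = ‖w‖) :
    ∃ Q : Matrix.orthogonalGroup (Fin m) ℝ, rotation Q v = w := by
  set f := (ℝ ∙ (v - w))ᗮ.reflection
  set b := EuclideanSpace.basisFun (Fin m) ℝ
  refine ⟨⟨_, f.toMatrix_mem_unitaryGroup b b⟩, ?_⟩
  rw [rotation_apply, Matrix.toEuclideanLin_eq_toLin_orthonormal]
  simp only [Matrix.toLin_toMatrix, b]
  exact Submodule.reflection_sub h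

lemma continuous_rotation (m : ℕ) :
    Continuous fun p : Matrix.orthogonalGroup (Fin m) ℝ × EuclideanSpace ℝ (Fin m) =>
      rotation p.1 p.2 := by
  simp only [rotation_apply, Matrix.toLpLin_apply]
  refine (PiLp.continuous_toLp 2 _).comp ?_
  exact Continuous.matrix_mulVec (continuous_subtype_val.comp continuous_fst)
    ((PiLp.continuous_ofLp 2 _).comp continuous_snd)

instance secondCountableTopologyMatrix (m : ℕ) :
    SecondCountableTopology (Matrix (Fin m) (Fin m) ℝ) :=
  inferInstanceAs (SecondCountableTopology (Fin m → Fin m → ℝ))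

instance locallyCompactSpaceOrthogonalGroup (m : ℕ) :
    LocallyCompactSpace (Matrix.orthogonalGroup (Fin m) ℝ) := by
  have : LocallyCompactSpace (Matrix (Fin m) (Fin m) ℝ) :=
    inferInstanceAs (LocallyCompactSpace (Fin m → Fin m → ℝ))
  have h := isClosed_unitary (R := Matrix (Fin m) (Fin m) ℝ)
  exact h.isClosedEmbedding_subtypeVal.locallyCompactSpace

instance topologicalGroupOrthogonalGroup (m : ℕ) :
    IsTopologicalGroup (Matrix.orthogonalGroup (Fin m) ℝ) :=
  inferInstanceAs (IsTopologicalGroup (unitary (Matrix (Fin m) (Fin m) ℝ)))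

instance secondCountableOrthogonalGroup (m : ℕ) :
    SecondCountableTopology (Matrix.orthogonalGroup (Fin m) ℝ) :=
  TopologicalSpace.Subtype.secondCountableTopology _

lemma isMulRightInvariant_of_isHaarMeasure {m : ℕ}
    (ν : Measure (Matrix.orthogonalGroup (Fin m) ℝ)) [IsProbabilityMeasure ν]
    [ν.IsHaarMeasure] : ν.IsMulRightInvariant := by
  -- A right translate of `ν` is again a Haar probability measure, hence equals `ν`.
  refine ⟨fun g => ?_⟩
  have : IsProbabilityMeasure (ν.map (· * g)) :=
    Measure.isProbabilityMeasure_map (by fun_prop)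
  exact Measure.isHaarMeasure_eq_of_isProbabilityMeasure _ _

/-- The law of `R v` for a Haar distributed `R` depends only on `‖v‖`. -/
lemma lintegral_rotation_eq_of_norm_eq {m : ℕ}
    (ν : Measure (Matrix.orthogonalGroup (Fin m) ℝ)) [IsProbabilityMeasure ν]
    [ν.IsHaarMeasure] (φ : EuclideanSpace ℝ (Fin m) → ℝ≥0∞) {v w : EuclideanSpace ℝ (Fin m)}
    (h : ‖v‖ = ‖w‖) : ∫⁻ R, φ (rotation R v) ∂ν = ∫⁻ R, φ (rotation R w) ∂ν := by
  have := isMulRightInvariant_of_isHaarMeasure ν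
  obtain ⟨Q, rfl⟩ := exists_rotation_eq h
  simp_rw [← rotation_mul]
  exact (lintegral_mul_right_eq_self (fun R => φ (rotation R v)) Q).symm

/-! ### Gaussian radial moments -/

/-- The unnormalized absolute moment `∫ ‖x‖ ^ t exp (-‖x‖²) dx` of a Gaussian vector in `ℝ ^ k`. -/
noncomputable def gaussianMoment (k : ℕ) (t : ℝ) : ℝ≥0∞ :=
  ∫⁻ x : EuclideanSpace ℝ (Fin k), ‖x‖ₑ ^ t * ENNReal.ofReal (Real.exp (-‖x‖ ^ 2))

lemma gaussianMoment_eq {k : ℕ} (hk : 0 < k) {t : ℝ} (ht : 0 < k + t) :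
    gaussianMoment k t = ENNReal.ofReal (k * volume.real (Metric.ball
      (0 : EuclideanSpace ℝ (Fin k)) 1) / 2 * Real.Gamma ((k + t) / 2)) := by
  have : Nonempty (Fin k) := ⟨⟨0, hk⟩⟩
  have : Nontrivial (EuclideanSpace ℝ (Fin k)) := inferInstance
  set f : ℝ → ℝ := fun r => r ^ t * Real.exp (-r ^ 2) with hf
  have hfr : ∀ r ∈ Set.Ioi (0 : ℝ), r ^ (Module.finrank ℝ (EuclideanSpace ℝ (Fin k)) - 1) • f r
      = r ^ ((k : ℝ) - 1 + t) * Real.exp (-r ^ (2 : ℝ)) := by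
    intro r hr
    rw [Set.mem_Ioi] at hr
    rw [finrank_euclideanSpace_fin, Real.rpow_add hr, ← Nat.cast_pred hk, Real.rpow_natCast,
      Real.rpow_two, smul_eq_mul, hf, mul_assoc]
  have hI : Integrable (fun x : EuclideanSpace ℝ (Fin k) => f ‖x‖) := by
    rw [integrable_fun_norm_addHaar, integrableOn_congr_fun hfr measurableSet_Ioi]
    exact integrableOn_rpow_mul_exp_neg_rpow (by linarith) two_pos
  have hval : ∫ x : EuclideanSpace ℝ (Fin k), f ‖x‖ = k * volume.real (Metric.ball
      (0 : EuclideanSpace ℝ (Fin k)) 1) / 2 * Real.Gamma ((k + t) / 2) := by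
    rw [integral_fun_norm_addHaar, setIntegral_congr_fun measurableSet_Ioi hfr,
      integral_rpow_mul_exp_neg_rpow two_pos (by linarith), finrank_euclideanSpace_fin,
      show (k : ℝ) - 1 + t + 1 = k + t by ring]
    simp only [nsmul_eq_mul, smul_eq_mul]
    ring
  rw [← hval, ofReal_integral_eq_lintegral_ofReal hI (.of_forall fun x => by positivity),
    gaussianMoment]
  refine lintegral_congr_ae ?_
  filter_upwards [compl_mem_ae_iff.2 (measure_singleton (0 : EuclideanSpace ℝ (Fin k)))] with x hx
  have hx' : 0 < ‖x‖ := norm_pos_iff.2 hx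
  rw [hf, ENNReal.ofReal_mul (by positivity), ← ofReal_norm, ENNReal.ofReal_rpow_of_pos hx']

/-! ### Moments of a single truncation -/

/-- The projection of `ℝ ^ (n + l)` onto the first `n` coordinates. -/
noncomputable def firstCoordinates (n l : ℕ) :
    EuclideanSpace ℝ (Fin (n + l)) →L[ℝ] EuclideanSpace ℝ (Fin n) :=
  (ContinuousLinearMap.fst ℝ _ _).comp
    (EuclideanSpace.finAddEquivProd (𝕜 := ℝ) (n := n) (m := l)).toContinuousLinearMap

lemma measurable_firstCoordinates_rotation_prod (n l : ℕ) :
    Measurable fun p : Matrix.orthogonalGroup (Fin (n + l)) ℝ × EuclideanSpace ℝ (Fin (n + l)) =>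
      firstCoordinates n l (rotation p.1 p.2) :=
  ((firstCoordinates n l).continuous.comp (continuous_rotation _)).measurable

lemma measurable_firstCoordinates_rotation (n l : ℕ) (x : EuclideanSpace ℝ (Fin (n + l))) :
    Measurable fun R : Matrix.orthogonalGroup (Fin (n + l)) ℝ =>
      firstCoordinates n l (rotation R x) :=
  ((firstCoordinates n l).continuous.comp
    ((continuous_rotation _).comp (Continuous.prodMk_left x))).measurable

/-- The embedding of `ℝ ^ n` into `ℝ ^ (n + l)` that appends `l` zeros. -/
noncomputable def appendZeros (n l : ℕ) (v : EuclideanSpace ℝ (Fin n)) :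
    EuclideanSpace ℝ (Fin (n + l)) :=
  (EuclideanSpace.finAddEquivProd (𝕜 := ℝ) (n := n) (m := l)).symm (v, 0)

lemma measurePreserving_finAddEquivProd (n l : ℕ) :
    MeasurePreserving (EuclideanSpace.finAddEquivProd (𝕜 := ℝ) (n := n) (m := l)) :=
  (WithLp.volume_preserving_ofLp _ _).comp
    (((LinearIsometryEquiv.piLpCongrLeft 2 ℝ ℝ finSumFinEquiv.symm).trans
      (PiLp.sumPiLpEquivProdLpPiLp (𝕜 := ℝ) 2 (fun _ : Fin n ⊕ Fin l => ℝ))).measurePreserving)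

lemma norm_sq_eq_add_finAddEquivProd (n l : ℕ) (x : EuclideanSpace ℝ (Fin (n + l))) :
    ‖x‖ ^ 2 = ‖(EuclideanSpace.finAddEquivProd x).1‖ ^ 2
      + ‖(EuclideanSpace.finAddEquivProd x).2‖ ^ 2 := by
  rw [← ((LinearIsometryEquiv.piLpCongrLeft 2 ℝ ℝ finSumFinEquiv.symm).trans
      (PiLp.sumPiLpEquivProdLpPiLp (𝕜 := ℝ) 2 (fun _ : Fin n ⊕ Fin l => ℝ))).norm_map x,
    WithLp.prod_norm_sq_eq_of_L2]
  rfl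

lemma norm_appendZeros (n l : ℕ) (v : EuclideanSpace ℝ (Fin n)) : ‖appendZeros n l v‖ = ‖v‖ := by
  have h := norm_sq_eq_add_finAddEquivProd n l (appendZeros n l v)
  rw [appendZeros, ContinuousLinearEquiv.apply_symm_apply] at h
  simp only [norm_zero, ne_eq, OfNat.ofNat_ne_zero, not_false_eq_true, zero_pow, add_zero] at h
  exact (pow_left_inj₀ (norm_nonneg _) (norm_nonneg _) two_ne_zero).1 h

lemma toEuclideanLin_truncation (n l : ℕ) (R : Matrix.orthogonalGroup (Fin (n + l)) ℝ)
    (v : EuclideanSpace ℝ (Fin n)) :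
    toEuclideanLin (truncation R) v = firstCoordinates n l (rotation R (appendZeros n l v)) := by
  ext i
  simp [truncation, firstCoordinates, appendZeros, rotation_apply, Matrix.toLpLin_apply,
    Matrix.mulVec, dotProduct, Fin.sum_univ_add]

lemma lintegral_firstCoordinates (n l : ℕ) (t : ℝ) :
    ∫⁻ x, ‖firstCoordinates n l x‖ₑ ^ t * ENNReal.ofReal (Real.exp (-‖x‖ ^ 2))
      = gaussianMoment n t * gaussianMoment l 0 := by
  set g : EuclideanSpace ℝ (Fin n) × EuclideanSpace ℝ (Fin l) → ℝ≥0∞ := fun p =>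
    (‖p.1‖ₑ ^ t * ENNReal.ofReal (Real.exp (-‖p.1‖ ^ 2))) *
      (‖p.2‖ₑ ^ (0 : ℝ) * ENNReal.ofReal (Real.exp (-‖p.2‖ ^ 2))) with hg
  have hgm : Measurable g := by fun_prop
  calc _ = ∫⁻ x, g (EuclideanSpace.finAddEquivProd (𝕜 := ℝ) x) := by
        refine lintegral_congr fun x => ?_
        simp only [firstCoordinates, hg]
        rw [norm_sq_eq_add_finAddEquivProd, neg_add, Real.exp_add,
          ENNReal.ofReal_mul (by positivity)]
        simp [mul_assoc]
    _ = ∫⁻ p, g p := (measurePreserving_finAddEquivProd n l).lintegral_comp hgm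
    _ = _ := lintegral_prod_mul
        (f := fun x : EuclideanSpace ℝ (Fin n) => ‖x‖ₑ ^ t * ENNReal.ofReal (Real.exp (-‖x‖ ^ 2)))
        (g := fun x : EuclideanSpace ℝ (Fin l) =>
          ‖x‖ₑ ^ (0 : ℝ) * ENNReal.ofReal (Real.exp (-‖x‖ ^ 2))) (by fun_prop) (by fun_prop)

/-- Integrating `‖firstCoordinates x‖ ^ t` against the rotation invariant Gaussian weight, with `x`
first rotated by a Haar distributed matrix, separates the radius from the direction. -/
lemma gaussianMoment_mul_lintegral {n l : ℕ} (hn : 0 < n)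
    (ν : Measure (Matrix.orthogonalGroup (Fin (n + l)) ℝ)) [IsProbabilityMeasure ν]
    [ν.IsHaarMeasure] {e : EuclideanSpace ℝ (Fin (n + l))} (he : ‖e‖ = 1) (t : ℝ) :
    gaussianMoment (n + l) t * ∫⁻ R, ‖firstCoordinates n l (rotation R e)‖ₑ ^ t ∂ν
      = gaussianMoment n t * gaussianMoment l 0 := by
  have : Nonempty (Fin (n + l)) := ⟨⟨0, by omega⟩⟩
  have : Nontrivial (EuclideanSpace ℝ (Fin (n + l))) := inferInstance
  have hmeas : Measurable fun p : Matrix.orthogonalGroup (Fin (n + l)) ℝ ×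
      EuclideanSpace ℝ (Fin (n + l)) => ‖firstCoordinates n l (rotation p.1 p.2)‖ₑ ^ t *
        ENNReal.ofReal (Real.exp (-‖p.2‖ ^ 2)) :=
    ((measurable_firstCoordinates_rotation_prod n l).enorm.pow_const t).mul (by fun_prop)
  have hmeas1 : ∀ x, Measurable fun R : Matrix.orthogonalGroup (Fin (n + l)) ℝ =>
      ‖firstCoordinates n l (rotation R x)‖ₑ ^ t := fun x =>
    (measurable_firstCoordinates_rotation n l x).enorm.pow_const t
  calc gaussianMoment (n + l) t * ∫⁻ R, ‖firstCoordinates n l (rotation R e)‖ₑ ^ t ∂ν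
      = ∫⁻ x, ∫⁻ R, ‖firstCoordinates n l (rotation R x)‖ₑ ^ t *
        ENNReal.ofReal (Real.exp (-‖x‖ ^ 2)) ∂ν := by
        rw [gaussianMoment, ← lintegral_mul_const _ (by fun_prop)]
        refine lintegral_congr_ae ?_
        filter_upwards [compl_mem_ae_iff.2
          (measure_singleton (0 : EuclideanSpace ℝ (Fin (n + l))))] with x hx
        rw [lintegral_mul_const _ (hmeas1 x),
          lintegral_rotation_eq_of_norm_eq ν (fun y => ‖firstCoordinates n l y‖ₑ ^ t)
            (v := x) (w := ‖x‖ • e) (by simp [norm_smul, he])]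
        simp_rw [map_smul, enorm_smul, enorm_norm]
        have h0 : ‖x‖ₑ ≠ 0 := by simpa using hx
        simp_rw [ENNReal.mul_rpow_of_ne_top enorm_ne_top enorm_ne_top]
        rw [lintegral_const_mul _ (hmeas1 e)]
        ring
    _ = ∫⁻ R, ∫⁻ x, ‖firstCoordinates n l (rotation R x)‖ₑ ^ t *
        ENNReal.ofReal (Real.exp (-‖x‖ ^ 2)) ∂volume ∂ν :=
        (lintegral_lintegral_swap hmeas.aemeasurable).symm
    _ = ∫⁻ _R, gaussianMoment n t * gaussianMoment l 0 ∂ν := by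
        refine lintegral_congr fun R => ?_
        rw [← lintegral_firstCoordinates, ← (rotation R).measurePreserving.lintegral_comp
          (f := fun x => ‖firstCoordinates n l x‖ₑ ^ t * ENNReal.ofReal (Real.exp (-‖x‖ ^ 2)))
          (by fun_prop)]
        simp only [LinearIsometryEquiv.norm_map]
    _ = gaussianMoment n t * gaussianMoment l 0 := by simp

/-- The moments of the norm of a truncated Haar matrix applied to a unit vector are those of the
square root of a `Beta(n/2, l/2)` variable. -/
lemma lintegral_truncation {n l : ℕ} (hn : 0 < n) (hl : 0 < l)
    (ν : Measure (Matrix.orthogonalGroup (Fin (n + l)) ℝ)) [IsProbabilityMeasure ν]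
    [ν.IsHaarMeasure] (v : EuclideanSpace ℝ (Fin n)) {t : ℝ} (ht : -(n : ℝ) < t) :
    ∫⁻ R, ‖toEuclideanLin (truncation R) v‖ₑ ^ t ∂ν
      = ‖v‖ₑ ^ t * ENNReal.ofReal (mgf Real.log (betaMeasure (n / 2) (l / 2)) (t / 2)) := by
  have hn' : (0 : ℝ) < n := by exact_mod_cast hn
  have hl' : (0 : ℝ) < l := by exact_mod_cast hl
  have hmgf := mgf_log_betaMeasure (a := n / 2) (b := l / 2) (t := t / 2) (by positivity)
    (by positivity) (by linarith)
  have hmgf0 : 0 < mgf Real.log (betaMeasure (n / 2) (l / 2)) (t / 2) := by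
    rw [hmgf]
    exact div_pos (beta_pos (by linarith) (by positivity)) (beta_pos (by positivity)
      (by positivity))
  by_cases hv : v = 0
  · subst hv
    rcases lt_trichotomy t 0 with h | h | h
    · simp [ENNReal.zero_rpow_of_neg h, ENNReal.top_mul, hmgf0]
    · subst h
      have := isProbabilityMeasureBeta (α := n / 2) (β := l / 2) (by positivity) (by positivity)
      simp
    · simp [ENNReal.zero_rpow_of_pos h]
  have hv0 : ‖v‖ ≠ 0 := norm_ne_zero_iff.2 hv
  set u := ‖v‖⁻¹ • v with hu
  have hu1 : ‖appendZeros n l u‖ = 1 := by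
    rw [norm_appendZeros, hu, norm_smul, norm_inv, norm_norm, inv_mul_cancel₀ hv0]
  have hvu : v = ‖v‖ • u := by rw [hu, smul_inv_smul₀ hv0]
  have hmeas : Measurable fun R : Matrix.orthogonalGroup (Fin (n + l)) ℝ =>
      ‖firstCoordinates n l (rotation R (appendZeros n l u))‖ₑ ^ t :=
    (measurable_firstCoordinates_rotation n l _).enorm.pow_const t
  have hscale : ∫⁻ R, ‖toEuclideanLin (truncation R) v‖ₑ ^ t ∂ν = ‖v‖ₑ ^ t *
      ∫⁻ R, ‖firstCoordinates n l (rotation R (appendZeros n l u))‖ₑ ^ t ∂ν := by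
    rw [← lintegral_const_mul _ hmeas]
    refine lintegral_congr fun R => ?_
    rw [← toEuclideanLin_truncation, ← ENNReal.mul_rpow_of_ne_top enorm_ne_top enorm_ne_top]
    conv_lhs => rw [hvu, map_smul, enorm_smul, enorm_norm]
  rw [hscale]
  congr 1
  have hF := gaussianMoment_mul_lintegral hn ν hu1 t
  -- The case of exponent zero eliminates the volumes of the unit balls.
  have hF0 := gaussianMoment_mul_lintegral hn ν hu1 0
  simp only [ENNReal.rpow_zero, lintegral_one, measure_univ, mul_one] at hF0
  set J := ∫⁻ R, ‖firstCoordinates n l (rotation R (appendZeros n l u))‖ₑ ^ t ∂ν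
  have hb : ∀ k : ℕ, 0 < volume.real (Metric.ball (0 : EuclideanSpace ℝ (Fin k)) 1) := fun k =>
    ENNReal.toReal_pos (Metric.measure_ball_pos _ _ one_pos).ne' measure_ball_lt_top.ne
  have g1 : 0 < Real.Gamma (((n + l : ℕ) + t) / 2) := Real.Gamma_pos_of_pos (by push_cast; linarith)
  have g2 : 0 < Real.Gamma ((n + t) / 2) := Real.Gamma_pos_of_pos (by linarith)
  have g3 : 0 < Real.Gamma ((n + 0) / 2 : ℝ) := Real.Gamma_pos_of_pos (by linarith)
  have g4 : 0 < Real.Gamma ((l + 0) / 2 : ℝ) := Real.Gamma_pos_of_pos (by linarith)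
  have g5 : 0 < Real.Gamma (((n + l : ℕ) + 0) / 2 : ℝ) :=
    Real.Gamma_pos_of_pos (by push_cast; linarith)
  rw [gaussianMoment_eq (by omega) (by push_cast; linarith), gaussianMoment_eq hn (by linarith),
    gaussianMoment_eq hl (by linarith)] at hF
  rw [gaussianMoment_eq (by omega) (by push_cast; linarith), gaussianMoment_eq hn (by linarith),
    gaussianMoment_eq hl (by linarith)] at hF0
  have b1 := hb (n + l)
  have b2 := hb n
  have b3 := hb l
  set c1 := volume.real (Metric.ball (0 : EuclideanSpace ℝ (Fin (n + l))) 1)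
  set c2 := volume.real (Metric.ball (0 : EuclideanSpace ℝ (Fin n)) 1)
  set c3 := volume.real (Metric.ball (0 : EuclideanSpace ℝ (Fin l)) 1)
  have hnl : (0 : ℝ) < (n + l : ℕ) := by positivity
  rw [← ENNReal.ofReal_mul (by positivity)] at hF hF0
  have hF0' := (ENNReal.ofReal_eq_ofReal_iff (by positivity) (by positivity)).1 hF0
  have hp : 0 < (n + l : ℕ) * c1 / 2 * Real.Gamma (((n + l : ℕ) + t) / 2) := by positivity
  rw [← ENNReal.eq_div_iff (by simpa using hp) ENNReal.ofReal_ne_top,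
    ← ENNReal.ofReal_div_of_pos hp] at hF
  rw [hF, hmgf]
  congr 1
  have e1 : ((n + l : ℕ) + t) / 2 = (n / 2 + t / 2 + l / 2 : ℝ) := by push_cast; ring
  have e2 : ((n + l : ℕ) + 0 : ℝ) / 2 = n / 2 + l / 2 := by push_cast; ring
  have e3 : (n + t) / 2 = n / 2 + t / 2 := by ring
  rw [add_zero] at g3 g4
  rw [e1] at g1 hp ⊢
  rw [e3] at g2 ⊢
  rw [e2] at g5 hF0'
  rw [add_zero, add_zero] at hF0'
  rw [add_zero, beta, beta]
  set A := Real.Gamma (n / 2)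
  set B := Real.Gamma (l / 2)
  set C := Real.Gamma (n / 2 + l / 2)
  set D := Real.Gamma (n / 2 + t / 2)
  set E := Real.Gamma (n / 2 + t / 2 + l / 2)
  rw [div_eq_div_iff hp.ne' (by positivity)]
  field_simp
  field_simp at hF0'
  linear_combination -hF0'

/-! ### Products of truncations -/

lemma toEuclideanLin_truncatedProduct_zero {n : ℕ} {l : Fin 0 → ℕ}
    (R : (i : Fin 0) → Matrix.orthogonalGroup (Fin (n + l i)) ℝ) (v : EuclideanSpace ℝ (Fin n)) :
    toEuclideanLin (truncatedProduct R) v = v := by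
  simp [truncatedProduct, orderedProduct]

lemma toEuclideanLin_truncatedProduct_succ {n N : ℕ} {l : Fin (N + 1) → ℕ}
    (R : (i : Fin (N + 1)) → Matrix.orthogonalGroup (Fin (n + l i)) ℝ)
    (v : EuclideanSpace ℝ (Fin n)) :
    toEuclideanLin (truncatedProduct R) v = toEuclideanLin (truncatedProduct fun i => R i.succ)
      (toEuclideanLin (truncation (R 0)) v) := by
  simp [truncatedProduct, orderedProduct, List.ofFn_succ, Matrix.toLpLin_apply,
    Matrix.mulVec_mulVec]

lemma continuous_truncation (n l : ℕ) :
    Continuous (truncation : Matrix.orthogonalGroup (Fin (n + l)) ℝ → _) :=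
  continuous_subtype_val.matrix_submatrix _ _

lemma continuous_truncatedProduct (n : ℕ) {N : ℕ} (l : Fin N → ℕ) :
    Continuous fun R : (i : Fin N) → Matrix.orthogonalGroup (Fin (n + l i)) ℝ =>
      truncatedProduct R := by
  simp only [truncatedProduct, orderedProduct, List.ofFn_eq_map, ← List.map_reverse]
  exact continuous_list_prod _ fun i _ => (continuous_truncation n (l i)).comp (continuous_apply i)

lemma _root_.Continuous.toEuclideanLin_const {X : Type*} [TopologicalSpace X] {n : ℕ}
    {A : X → Matrix (Fin n) (Fin n) ℝ} (hA : Continuous A) (v : EuclideanSpace ℝ (Fin n)) :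
    Continuous fun x => toEuclideanLin (A x) v := by
  simp only [Matrix.toLpLin_apply]
  exact (PiLp.continuous_toLp 2 _).comp (hA.matrix_mulVec continuous_const)

lemma measurable_toEuclideanLin_truncatedProduct (n : ℕ) {N : ℕ} (l : Fin N → ℕ)
    (v : EuclideanSpace ℝ (Fin n)) :
    Measurable fun R : (i : Fin N) → Matrix.orthogonalGroup (Fin (n + l i)) ℝ =>
      toEuclideanLin (truncatedProduct R) v :=
  ((continuous_truncatedProduct n l).toEuclideanLin_const v).measurable

/-- The moments of `‖X v‖` factorize: conditionally on the first factor, the remaining product acts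
on a fixed vector. -/
lemma lintegral_truncatedProduct {n : ℕ} (hn : 0 < n) {N : ℕ} (l : Fin N → ℕ) (hl : ∀ i, 0 < l i)
    (ν : (i : Fin N) → Measure (Matrix.orthogonalGroup (Fin (n + l i)) ℝ))
    [∀ i, IsProbabilityMeasure (ν i)] [∀ i, (ν i).IsHaarMeasure]
    (v : EuclideanSpace ℝ (Fin n)) {t : ℝ} (ht : -(n : ℝ) < t) :
    ∫⁻ R, ‖toEuclideanLin (truncatedProduct R) v‖ₑ ^ t ∂Measure.pi ν
      = ‖v‖ₑ ^ t *
        ∏ i, ENNReal.ofReal (mgf Real.log (betaMeasure (n / 2) (l i / 2)) (t / 2)) := by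
  induction N generalizing v with
  | zero => simp [toEuclideanLin_truncatedProduct_zero]
  | succ N ih =>
    have hmeas := (measurable_toEuclideanLin_truncatedProduct n l v).enorm.pow_const t
    rw [← (measurePreserving_piFinSuccAbove ν 0).symm.lintegral_comp hmeas]
    refine (lintegral_prod _ (hmeas.comp (MeasurableEquiv.measurable _)).aemeasurable).trans ?_
    simp only [Function.comp_apply]
    have hstep : ∀ x y, toEuclideanLin (truncatedProduct
        ((MeasurableEquiv.piFinSuccAbove (fun i => Matrix.orthogonalGroup (Fin (n + l i)) ℝ) 0).symm
          (x, y))) v = toEuclideanLin (truncatedProduct (l := fun i => l i.succ) y)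
            (toEuclideanLin (truncation x) v) := fun x y => by
      rw [toEuclideanLin_truncatedProduct_succ]
      rfl
    simp_rw [hstep]
    have hm1 : Measurable fun x : Matrix.orthogonalGroup (Fin (n + l 0)) ℝ =>
        ‖toEuclideanLin (truncation x) v‖ₑ ^ t :=
      ((continuous_truncation n (l 0)).toEuclideanLin_const v).measurable.enorm.pow_const t
    refine (lintegral_congr fun x => ih (fun i => l i.succ) (fun i => hl _) (fun i => ν i.succ)
      (toEuclideanLin (truncation (l := l 0) x) v)).trans ?_
    rw [lintegral_mul_const _ hm1, lintegral_truncation hn (hl 0) (ν 0) v ht, Fin.prod_univ_succ,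
      mul_assoc]

/-! ### Chernoff's bound and the rates -/

/-- Chernoff's bound under a sub-exponential estimate of the moment generating function. -/
lemma measureReal_le_of_mgf_le {Ω : Type*} [MeasurableSpace Ω] {P : Measure Ω}
    [IsProbabilityMeasure P] {Y : Ω → ℝ} {n N m s : ℝ} (hn : 0 < n) (hN : 0 < N) (hs : 0 < s)
    (hint : ∀ t, |t| ≤ n / 2 → Integrable (fun ω => Real.exp (t * Y ω)) P)
    (hmgf : ∀ t, |t| ≤ n / 2 → mgf Y P t ≤ Real.exp (t * m + N * (5 / 2 * t ^ 2 / n))) :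
    P.real {ω | N * s ≤ |Y ω - m|} ≤ 2 * Real.exp (-(N * n * min (s ^ 2) s / 10)) := by
  -- `τ` minimizes the exponent `5 τ² / (2 n) - τ s` over `0 ≤ τ ≤ n / 5`.
  set τ := n / 5 * min s 1 with hτ
  have hmin : 0 < min s 1 := lt_min hs one_pos
  have hτ0 : 0 < τ := by positivity
  have hτn : |τ| ≤ n / 2 := by
    rw [abs_of_pos hτ0]
    have := min_le_right s 1
    nlinarith
  have hexp : N * (5 / 2 * τ ^ 2 / n) - τ * (N * s) ≤ -(N * n * min (s ^ 2) s / 10) := by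
    have h1 : 5 / 2 * τ ^ 2 / n = n * (min s 1) ^ 2 / 10 := by rw [hτ]; field_simp; norm_num
    rw [h1, hτ]
    have hNn : 0 < N * n := by positivity
    rcases le_total s 1 with h | h
    · rw [min_eq_left h, min_eq_left (by nlinarith)]
      nlinarith
    · rw [min_eq_right h, min_eq_right (by nlinarith)]
      nlinarith
  have hup : P.real {ω | m + N * s ≤ Y ω} ≤ Real.exp (-(N * n * min (s ^ 2) s / 10)) := by
    refine (measure_ge_le_exp_mul_mgf _ hτ0.le (hint τ hτn)).trans ?_
    refine (mul_le_mul_of_nonneg_left (hmgf τ hτn) (Real.exp_pos _).le).trans ?_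
    rw [← Real.exp_add, Real.exp_le_exp]
    linarith
  have hlow : P.real {ω | Y ω ≤ m - N * s} ≤ Real.exp (-(N * n * min (s ^ 2) s / 10)) := by
    have hτn' : |-τ| ≤ n / 2 := by rwa [abs_neg]
    refine (measure_le_le_exp_mul_mgf _ (neg_nonpos.2 hτ0.le) (hint (-τ) hτn')).trans ?_
    refine (mul_le_mul_of_nonneg_left (hmgf (-τ) hτn') (Real.exp_pos _).le).trans ?_
    rw [← Real.exp_add, Real.exp_le_exp]
    rw [neg_sq]
    linarith
  have hsub : {ω | N * s ≤ |Y ω - m|} ⊆ {ω | m + N * s ≤ Y ω} ∪ {ω | Y ω ≤ m - N * s} := by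
    intro ω hω
    rcases le_abs.1 (show N * s ≤ |Y ω - m| from hω) with h | h
    · left
      rw [Set.mem_ofPred_eq]
      linarith
    · right
      rw [Set.mem_ofPred_eq]
      linarith
  calc P.real {ω | N * s ≤ |Y ω - m|}
      ≤ P.real ({ω | m + N * s ≤ Y ω} ∪ {ω | Y ω ≤ m - N * s}) := measureReal_mono hsub
    _ ≤ _ := measureReal_union_le _ _
    _ ≤ _ := by linarith

lemma rate_pos {n l : ℕ} (hn : 0 < n) : 0 < rate n l := by
  have : (0 : ℝ) < n := by exact_mod_cast hn
  unfold rate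
  positivity

lemma rate_le {n l : ℕ} (hn : 0 < n) (hl : 0 < l) : rate n l ≤ 2 * n := by
  have hn' : (0 : ℝ) < n := by exact_mod_cast hn
  have hl' : (1 : ℝ) ≤ l := by exact_mod_cast hl
  unfold rate
  rw [div_le_iff₀ (by positivity)]
  have : (n : ℝ) * (n + l + 2) ≤ 2 * (n + l) ^ 2 := by nlinarith
  nlinarith

lemma harmonicRate_le {n N : ℕ} (hn : 0 < n) (hN : 0 < N) {l : Fin N → ℕ} (hl : ∀ i, 0 < l i) :
    harmonicRate n l ≤ 2 * n := by
  have hn' : (0 : ℝ) < n := by exact_mod_cast hn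
  have hN' : (0 : ℝ) < N := by exact_mod_cast hN
  have h : N * (1 / (2 * n : ℝ)) ≤ ∑ i, 1 / rate n (l i) := by
    have := Finset.card_nsmul_le_sum Finset.univ (fun i => 1 / rate n (l i)) (1 / (2 * n : ℝ))
      fun i _ => one_div_le_one_div_of_le (rate_pos hn) (rate_le hn (hl i))
    simpa using this
  unfold harmonicRate
  rw [div_le_iff₀ (lt_of_lt_of_le (by positivity) h)]
  calc (N : ℝ) = 2 * n * (N * (1 / (2 * n))) := by field_simp
    _ ≤ _ := by gcongr

/-! ### The moment generating function of the logarithm of the norm -/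

/-- The logarithm of `‖X θ‖` for a unit vector `θ` has the moment generating function of half a sum
of independent logarithms of beta variables. -/
lemma lintegral_exp_mul_log_norm {n N : ℕ} (hn : 0 < n) {l : Fin N → ℕ} (hl : ∀ i, 0 < l i)
    {Ω : Type*} [MeasurableSpace Ω] {P : Measure Ω} [IsProbabilityMeasure P]
    {R : (i : Fin N) → Ω → Matrix.orthogonalGroup (Fin (n + l i)) ℝ}
    (hR : ∀ i, IsHaarDistributed P (R i)) (hind : iIndepFun R P)
    {θ : EuclideanSpace ℝ (Fin n)} (hθ : ‖θ‖ = 1) {t : ℝ} (ht : -(n : ℝ) < t) :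
    ∫⁻ ω, ENNReal.ofReal (Real.exp (t * Real.log
        ‖toEuclideanLin (truncatedProduct fun i => R i ω) θ‖)) ∂P
      = ∏ i, ENNReal.ofReal (mgf Real.log (betaMeasure (n / 2) (l i / 2)) (t / 2)) := by
  have hp : ∀ i, IsProbabilityMeasure (P.map (R i)) := fun i =>
    Measure.isProbabilityMeasure_map (hR i).1.aemeasurable
  have hh : ∀ i, (P.map (R i)).IsHaarMeasure := fun i => (hR i).2
  have hRm : Measurable fun ω i => R i ω := measurable_pi_lambda _ fun i => (hR i).1
  have hmom : ∀ u : ℝ, -(n : ℝ) < u →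
      ∫⁻ ω, ‖toEuclideanLin (truncatedProduct fun i => R i ω) θ‖ₑ ^ u ∂P
        = ∏ i, ENNReal.ofReal (mgf Real.log (betaMeasure (n / 2) (l i / 2)) (u / 2)) := by
    intro u hu
    have h := lintegral_truncatedProduct hn l hl (fun i => P.map (R i)) θ hu
    rw [← hind.map_fun_eq_pi_map fun i => (hR i).1.aemeasurable, lintegral_map
      ((measurable_toEuclideanLin_truncatedProduct n l θ).enorm.pow_const u) hRm,
      ← ofReal_norm θ, hθ] at h
    simpa using h
  have hXm := (measurable_toEuclideanLin_truncatedProduct n l θ).comp hRm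
  have hn1 : (1 : ℝ) ≤ n := by exact_mod_cast hn
  -- A finite negative moment excludes the value zero, where `Real.log` would be a junk value.
  have hne : ∀ᵐ ω ∂P, toEuclideanLin (truncatedProduct fun i => R i ω) θ ≠ 0 := by
    have hfin : ∫⁻ ω, ‖toEuclideanLin (truncatedProduct fun i => R i ω) θ‖ₑ ^ (-1 / 2 : ℝ) ∂P
        ≠ ∞ := by
      rw [hmom _ (by linarith)]
      exact ENNReal.prod_ne_top fun i _ => ENNReal.ofReal_ne_top
    filter_upwards [ae_lt_top (hXm.enorm.pow_const _) hfin] with ω hω h0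
    simp [h0, ENNReal.zero_rpow_of_neg (show (-1 / 2 : ℝ) < 0 by norm_num)] at hω
  rw [← hmom t ht]
  refine lintegral_congr_ae ?_
  filter_upwards [hne] with ω hω
  have hpos := norm_pos_iff.2 hω
  rw [mul_comm, ← Real.rpow_def_of_pos hpos, ← ENNReal.ofReal_rpow_of_pos hpos, ofReal_norm]

end TruncatedProduct

theorem proposition4 :
    ∃ c : ℝ, 0 < c ∧
      ∀ (n N : ℕ) (_ : 0 < n) (hN : 0 < N) (l : Fin N → ℕ) (_ : ∀ i, 0 < l i)
        (Ω : Type*) [MeasurableSpace Ω] (P : Measure Ω) [IsProbabilityMeasure P]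
        (R : (i : Fin N) → Ω → Matrix.orthogonalGroup (Fin (n + l i)) ℝ)
        (_ : ∀ i, TruncatedProduct.IsHaarDistributed P (R i))
        (_ : iIndepFun R P)
        (θ : EuclideanSpace ℝ (Fin n)) (_ : ‖θ‖ = 1) (s : ℝ) (_ : 0 < s),
        P.real {ω | s ≤ |1 / (N : ℝ) *
              Real.log ‖Matrix.toEuclideanLin
                (TruncatedProduct.truncatedProduct fun i => R i ω) θ‖
            - TruncatedProduct.averageMean n l / 2|}
          ≤ 2 * Real.exp (-c * N *
              min (TruncatedProduct.harmonicRate n l * s ^ 2)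
                (TruncatedProduct.rate n (l ⟨N - 1, Nat.sub_one_lt_of_lt hN⟩) * s)) := by
  -- Chernoff's bound has the constant `1 / 10`, and both rates are at most `2 n`.
  refine ⟨1 / 20, by norm_num, ?_⟩
  intro n N hn hN l hl Ω _ P _ R hR hind θ hθ s hs
  have hn' : (0 : ℝ) < n := by exact_mod_cast hn
  have hn1 : (1 : ℝ) ≤ n := by exact_mod_cast hn
  have hN' : (0 : ℝ) < N := by exact_mod_cast hN
  set Y : Ω → ℝ := fun ω => Real.log ‖Matrix.toEuclideanLin
    (TruncatedProduct.truncatedProduct fun i => R i ω) θ‖ with hY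
  have hYm : Measurable Y := ((TruncatedProduct.measurable_toEuclideanLin_truncatedProduct n l
    θ).comp (measurable_pi_lambda _ fun i => (hR i).1)).norm.log
  have hlint : ∀ t : ℝ, |t| ≤ n / 2 → _ := fun t ht =>
    TruncatedProduct.lintegral_exp_mul_log_norm hn hl hR hind hθ (t := t)
      (by linarith [neg_abs_le t])
  have hint : ∀ t : ℝ, |t| ≤ n / 2 → Integrable (fun ω => Real.exp (t * Y ω)) P := by
    intro t ht
    refine ⟨by fun_prop, ?_⟩
    rw [hasFiniteIntegral_iff_ofReal (.of_forall fun ω => (Real.exp_pos _).le), hlint t ht]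
    exact (ENNReal.prod_ne_top fun i _ => ENNReal.ofReal_ne_top).lt_top
  set m := (∑ i, TruncatedProduct.logBetaMean n (l i)) / 2 with hm
  have hmgf : ∀ t : ℝ, |t| ≤ n / 2 → mgf Y P t ≤ Real.exp (t * m + N * (5 / 2 * t ^ 2 / n)) := by
    intro t ht
    rw [mgf, integral_eq_lintegral_of_nonneg_ae (.of_forall fun ω => (Real.exp_pos _).le)
      (by fun_prop), hlint t ht, ENNReal.toReal_prod]
    calc ∏ i, (ENNReal.ofReal (mgf Real.log (betaMeasure (n / 2) (l i / 2)) (t / 2))).toReal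
        ≤ ∏ i, Real.exp (t / 2 * TruncatedProduct.logBetaMean n (l i)
          + 5 / (n / 2) * (t / 2) ^ 2) := by
          refine Finset.prod_le_prod (fun i _ => ENNReal.toReal_nonneg) fun i _ => ?_
          rw [ENNReal.toReal_ofReal mgf_nonneg]
          have hli : (0 : ℝ) < l i := by exact_mod_cast hl i
          exact TruncatedProduct.mgf_log_betaMeasure_le (by linarith) (by positivity)
            (by linarith [neg_abs_le t])
      _ = Real.exp (t * m + N * (5 / 2 * t ^ 2 / n)) := by
          rw [← Real.exp_sum, Finset.sum_add_distrib, ← Finset.mul_sum, hm]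
          simp only [Finset.sum_const, Finset.card_univ, Fintype.card_fin, nsmul_eq_mul]
          congr 1
          field_simp
  have hset : {ω | s ≤ |1 / (N : ℝ) * Y ω - TruncatedProduct.averageMean n l / 2|}
      = {ω | N * s ≤ |Y ω - m|} := by
    ext ω
    have : 1 / (N : ℝ) * Y ω - TruncatedProduct.averageMean n l / 2 = (Y ω - m) / N := by
      rw [TruncatedProduct.averageMean, hm]
      ring
    rw [Set.mem_ofPred_eq, Set.mem_ofPred_eq, this, abs_div, abs_of_pos hN', le_div_iff₀ hN',
      mul_comm s]
  change P.real {ω | s ≤ |1 / (N : ℝ) * Y ω - TruncatedProduct.averageMean n l / 2|} ≤ (_ : ℝ)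
  rw [hset]
  refine (TruncatedProduct.measureReal_le_of_mgf_le hn' hN' hs hint hmgf).trans ?_
  gcongr
  have h1 : TruncatedProduct.harmonicRate n l * s ^ 2 ≤ 2 * n * s ^ 2 := by
    gcongr
    exact TruncatedProduct.harmonicRate_le hn hN hl
  have h2 : TruncatedProduct.rate n (l ⟨N - 1, Nat.sub_one_lt_of_lt hN⟩) * s ≤ 2 * n * s := by
    gcongr
    exact TruncatedProduct.rate_le hn (hl _)
  have h3 := min_le_min h1 h2
  rw [← mul_min_of_nonneg _ _ (by positivity : (0 : ℝ) ≤ 2 * n)] at h3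
  have h4 := mul_le_mul_of_nonneg_left h3 hN'.le
  linarith
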